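/- Let $a,b>0$. For $c\in\mathbb R$ and $f\in L^2(\mathbb R)$ (complex-valued) put $E_cf(x)=e^{2\pi i c x}f(x)$ and $T_cf(x)=f(x-c)$; the inner product $\langle\cdot,\cdot\rangle$ is linear in the first variable. A family $(f_i)_{i\in I}$ in a Hilbert space $H$ is a frame for $H$ if there are constants $A,B>0$ with $A\|f\|^2\le\sum_{i}|\langle f,f_i\rangle|^2\le B\|f\|^2$ for all $f\in H$; its frame operator is the invertible operator $Sf=\sum_i\langle f,f_i\rangle f_i$. A family $(h_i)_{i\in I}$ is an alternate dual frame for the frame $(f_i)_{i\in I}$ if $(h_i)$ is itself a frame for $H$ and $f=\sum_i\langle f,h_i\rangle f_i$ (unconditionally convergent) for all $f\in H$. Let $\mathbf{PF}$ be the set of $g\in L^2(\mathbb R)$ for which there is $B>0$ with $\sum_{m,n\in\mathbb Z}|\langle f,E_{mb}T_{na}g\rangle|^2\le B\|f\|^2$ for all $f\in L^2(\mathbb R)$. Theorem 4.1. Let $g,h\in\mathbf{PF}$ be such that $(E_{mb}T_{na}g)_{m,n\in\mathbb Z}$ is a frame for $L^2(\mathbb R)$, with frame operator $S$. The following are equivalent: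 (1) $(E_{mb}T_{na}h)_{m,n\in\mathbb Z}$ is an alternate dual frame for $(E_{mb}T_{na}g)_{m,n\in\mathbb Z}$. (2) (a) $\sum_{n\in\mathbb Z}h(x-na)\overline{g(x-na-k/b)}=0$ for a.e. $x\in\mathbb R$, for every integer $k\ne0$; and (b) $\sum_{n\in\mathbb Z}h(x-na)\overline{g(x-na)}=b$ for a.e. $x\in\mathbb R$ (the series converging absolutely for a.e. $x$). (3) $h=S^{-1}g+f$ for some $f\in L^2(\mathbb R)$ that is orthogonal to the linear span of $\{E_{n/a}T_{m/b}g : m,n\in\mathbb Z\}$. -/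

import Mathlib

open MeasureTheory

noncomputable section

namespace WeylHeisenberg

section Frames

variable {ι H : Type*} [NormedAddCommGroup H] [InnerProductSpace ℂ H]

/-- The family `(f i)` has a finite upper frame bound. Mathlib's inner product is linear in the
second variable, so the mathematician's `⟨x, f i⟩`, linear in `x`, is `inner ℂ (f i) x`. -/
def HasUpperFrameBound (f : ι → H) : Prop :=
  ∃ B : ℝ, 0 < B ∧ ∀ x : H, (Summable fun i => ‖inner ℂ (f i) x‖ ^ 2) ∧
    ∑' i, ‖inner ℂ (f i) x‖ ^ 2 ≤ B * ‖x‖ ^ 2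

/-- `(f i)` is a frame: `A ‖x‖² ≤ ∑ |⟨x, f i⟩|² ≤ B ‖x‖²` for all `x`, with `A, B > 0`. -/
def IsFrame (f : ι → H) : Prop :=
  ∃ A B : ℝ, 0 < A ∧ 0 < B ∧ ∀ x : H, (Summable fun i => ‖inner ℂ (f i) x‖ ^ 2) ∧
    A * ‖x‖ ^ 2 ≤ ∑' i, ‖inner ℂ (f i) x‖ ^ 2 ∧
    ∑' i, ‖inner ℂ (f i) x‖ ^ 2 ≤ B * ‖x‖ ^ 2

/-- The frame operator `S x = ∑ ⟨x, f i⟩ f i`. -/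
def frameOperator (f : ι → H) (x : H) : H := ∑' i, inner ℂ (f i) x • f i

/-- `(h i)` is an alternate dual frame for the frame `(f i)`: it is a frame, and
`x = ∑ ⟨x, h i⟩ f i` (unconditionally convergent) for all `x`. -/
def IsAlternateDualFrame (h f : ι → H) : Prop :=
  IsFrame h ∧ ∀ x : H, HasSum (fun i => inner ℂ (h i) x • f i) x

/-- The analysis operator of a frame, `x ↦ (⟨x, f i⟩)`, with values in `ℓ²`. -/
theorem IsFrame.exists_analysis {f : ι → H} (hf : IsFrame f) :
    ∃ (T : H →L[ℂ] lp (fun _ : ι => ℂ) 2) (A : ℝ), 0 < A ∧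
      (∀ x i, T x i = inner ℂ (f i) x) ∧ ∀ x, A * ‖x‖ ^ 2 ≤ ‖T x‖ ^ 2 := by
  obtain ⟨A, B, hA, hB, h⟩ := hf
  have hmem : ∀ x : H, Memℓp (fun i => inner ℂ (f i) x) 2 := fun x => by
    refine memℓp_gen ?_
    simpa using (h x).1
  have hnorm : ∀ y : lp (fun _ : ι => ℂ) 2, ‖y‖ ^ 2 = ∑' i, ‖y i‖ ^ 2 := fun y => by
    have := lp.norm_rpow_eq_tsum (p := 2) (by norm_num) y
    simpa using this
  let T₀ : H →ₗ[ℂ] lp (fun _ : ι => ℂ) 2 :=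
    { toFun := fun x => ⟨fun i => inner ℂ (f i) x, hmem x⟩
      map_add' := fun x y => by
        ext i
        exact inner_add_right _ _ _
      map_smul' := fun c x => by
        ext i
        exact inner_smul_right _ _ _ }
  have hT₀ : ∀ x i, T₀ x i = inner ℂ (f i) x := fun _ _ => rfl
  have hbound : ∀ x, ‖T₀ x‖ ≤ Real.sqrt B * ‖x‖ := fun x => by
    refine abs_le_of_sq_le_sq' ?_ (by positivity) |>.2
    rw [hnorm, mul_pow, Real.sq_sqrt hB.le]
    simpa only [hT₀] using (h x).2.2
  refine ⟨T₀.mkContinuous _ hbound, A, hA, hT₀, fun x => ?_⟩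
  rw [hnorm]
  exact (h x).2.1

/-- The frame operator of a frame is invertible. -/
theorem IsFrame.bijective_frameOperator [CompleteSpace H] {f : ι → H} (hf : IsFrame f) :
    Function.Bijective (frameOperator f) := by
  classical
  obtain ⟨T, A, hA, hT, hlow⟩ := hf.exists_analysis
  have hadj : ∀ (i : ι) (c : ℂ), T.adjoint (lp.single 2 i c) = c • f i := fun i c => by
    refine ext_inner_left ℂ fun x => ?_
    rw [ContinuousLinearMap.adjoint_inner_right, lp.inner_single_right, hT, inner_smul_right]
    simp
  have hS : ∀ x, frameOperator f x = (T.adjoint ∘L T) x := fun x => by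
    have h1 := (lp.hasSum_single (p := 2) (by norm_num) (T x)).mapL T.adjoint
    simp only [hadj, hT] at h1
    exact h1.tsum_eq
  have hunit : IsUnit (T.adjoint ∘L T) := by
    refine ContinuousLinearMap.isUnit_of_forall_le_norm_inner_map _ (c := A.toNNReal)
      (Real.toNNReal_pos.mpr hA) fun x => ?_
    rw [ContinuousLinearMap.comp_apply, ContinuousLinearMap.adjoint_inner_left,
      inner_self_eq_norm_sq_to_K]
    have h2 := hlow x
    rw [mul_comm] at h2
    simpa [Real.coe_toNNReal A hA.le] using h2
  have heq : frameOperator f = (T.adjoint ∘L T) := funext hS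
  rw [heq]
  exact ContinuousLinearMap.isUnit_iff_bijective.mp hunit

/-- The frame operator of a frame as a bijection; its inverse is `S⁻¹`. -/
def IsFrame.frameOperatorEquiv [CompleteSpace H] {f : ι → H} (hf : IsFrame f) : H ≃ H :=
  Equiv.ofBijective (frameOperator f) hf.bijective_frameOperator

end Frames

/-- The complex Hilbert space `L²(ℝ)`. -/
abbrev L2 : Type := Lp ℂ 2 (volume : Measure ℝ)

/-- Translation `T_c f (x) = f (x - c)`. -/
def translate (c : ℝ) (f : L2) : L2 :=
  Lp.compMeasurePreserving (fun x : ℝ => x - c) (measurePreserving_sub_right volume c) f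

theorem memLp_modulate (c : ℝ) (f : L2) :
    MemLp (fun x : ℝ => Complex.exp (2 * Real.pi * Complex.I * c * x) * f x) 2 volume := by
  refine (Lp.memLp f).of_le (AEStronglyMeasurable.mul ?_ (Lp.aestronglyMeasurable f)) ?_
  · exact Continuous.aestronglyMeasurable (by fun_prop)
  · refine Filter.Eventually.of_forall fun x => ?_
    have : (2 * Real.pi * Complex.I * c * x : ℂ) = ((2 * Real.pi * c * x : ℝ) : ℂ) * Complex.I := by
      push_cast
      ring
    rw [norm_mul, this, Complex.norm_exp_ofReal_mul_I, one_mul]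

/-- Modulation `E_c f (x) = exp (2 π i c x) f (x)`. -/
def modulate (c : ℝ) (f : L2) : L2 := (memLp_modulate c f).toLp

/-- The Weyl-Heisenberg system `(E_{mb} T_{na} g)`, indexed by `(m, n)`. -/
def whSystem (a b : ℝ) (g : L2) (p : ℤ × ℤ) : L2 :=
  modulate (p.1 * b) (translate (p.2 * a) g)

/-- The class `PF`, for given parameters `a, b`: the `g` in `L²(ℝ)` for which
`(E_{mb} T_{na} g)` has a finite upper frame bound. -/
def PF (a b : ℝ) : Set L2 := {g | HasUpperFrameBound (whSystem a b g)}

end WeylHeisenberg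

end

/-!
The theorem rests on the correlations `∑ₙ h(x - na) conj g(x - na - k/b)` of the two windows, one
for each integer `k`.

Reconstruction and correlations are linked by the Weyl-Heisenberg frame identity. Take indicator
functions of sets `s` and `t`, where `s` lies in an interval of length at most `min a (1/b)` and `t`
in the shift by `-k/b` of an interval of length `1/b` containing `s`. Parseval's identity for the
modulations `E_{mb}`, followed by summation over the translations `T_{na}`, shows that
`∑ ⟨1_s, h_{mn}⟩ ⟨g_{mn}, 1_t⟩` (here `⟨·,·⟩` is Mathlib's inner product) equals `1/b` times the
integral of the `k`-th correlation over the part of `s` whose shift lies in `t`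
(`eq_setIntegral_of_hasSum_inner_mul_inner`). The left side is `⟨1_s, 1_t⟩` when reconstruction
holds; varying `s` yields the value of each correlation (`ae_hasSum_correlation_of_hasSum`).
Conversely, since such indicator functions are total in `L²(ℝ)`, the values of the correlations
force the mixed frame operator to be the identity (`hasSum_of_ae_hasSum_correlation`), and the lower
frame bound for `h` follows (`HasUpperFrameBound.isAlternateDualFrame`).

Correlations and orthogonality are linked by Fourier series with period `a`: the `k`-th correlation
is the periodization of an integrable function, and its Fourier coefficients are inner products of
`h` with the system `E_{m/a} T_{k/b} g` on the dual lattice (`ae_hasSum_correlation_iff_inner`). The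
correlation conditions therefore prescribe the inner products of `h` with that system. The window
`S⁻¹ g` has the prescribed inner products, because the frame operator commutes with the
time-frequency shifts involved and the canonical dual frame reconstructs
(`IsFrame.hasSum_whSystem_canonicalDual`). Hence `h` satisfies the conditions exactly when
`h - S⁻¹ g` is orthogonal to the system.
-/

noncomputable section

namespace WeylHeisenberg

/-! ### Fourier series on an interval -/

section Fourier

open Set

/-- Parseval's identity on an interval of length `T`, polarized. The characters enter without
conjugation, which amounts to summing over the frequencies in reverse order. -/
theorem hasSum_parseval_interval {T : ℝ} (hT : 0 < T) (c : ℝ) {u v : ℝ → ℂ}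
    (hu : MemLp u 2 (volume.restrict (Ioc c (c + T))))
    (hv : MemLp v 2 (volume.restrict (Ioc c (c + T)))) :
    HasSum (fun m : ℤ => (∫ x in Ioc c (c + T), u x * fourier m (x : AddCircle T)) *
        starRingEnd ℂ (∫ x in Ioc c (c + T), v x * fourier m (x : AddCircle T)))
      (T * ∫ x in Ioc c (c + T), u x * starRingEnd ℂ (v x)) := by
  have := Fact.mk hT
  have hlt : c < c + T := lt_add_of_pos_right c hT
  have hU := hu.memLp_liftIoc.haarAddCircle
  have hV := hv.memLp_liftIoc.haarAddCircle
  have coeff : ∀ {w : ℝ → ℂ} (hw : MemLp (AddCircle.liftIoc T c w) 2 AddCircle.haarAddCircle)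
      (m : ℤ), fourierBasis.repr hw.toLp (-m) =
        (T : ℂ)⁻¹ * ∫ x in Ioc c (c + T), w x * fourier m (x : AddCircle T) := by
    intro w hw m
    rw [fourierBasis_repr, fourierCoeff_congr_ae hw.coeFn_toLp, fourierCoeff_liftIoc_eq,
      fourierCoeffOn_eq_integral, intervalIntegral.integral_of_le hlt.le]
    simp only [fourier_coe_apply, add_sub_cancel_left, neg_neg, smul_eq_mul, one_div,
      Complex.real_smul, Complex.ofReal_inv, mul_comm (w _)]
  -- Mathlib's Fourier coefficients integrate against `fourier (-m)`; the negation is undone here.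
  have key := (Equiv.neg ℤ).hasSum_iff.mpr (fourierBasis.hasSum_inner_mul_inner hV.toLp hU.toLp)
  have hinner : inner ℂ hV.toLp hU.toLp =
      (T : ℂ)⁻¹ * ∫ x in Ioc c (c + T), u x * starRingEnd ℂ (v x) := by
    rw [L2.inner_def]
    have h1 : ∫ t, inner ℂ ((hV.toLp _ : _ → ℂ) t) ((hU.toLp _ : _ → ℂ) t) ∂AddCircle.haarAddCircle =
        ∫ t, AddCircle.liftIoc T c (fun x => u x * starRingEnd ℂ (v x)) t
          ∂AddCircle.haarAddCircle := by
      refine integral_congr_ae ?_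
      filter_upwards [hU.coeFn_toLp, hV.coeFn_toLp] with t h1 h2
      rw [h1, h2, RCLike.inner_apply]
      simp only [AddCircle.liftIoc, Function.comp_apply, domRestrict_apply]
    rw [h1, AddCircle.integral_haarAddCircle, AddCircle.integral_liftIoc_eq_intervalIntegral,
      intervalIntegral.integral_of_le hlt.le]
    simp
  rw [hinner] at key
  have key2 := key.mul_left ((T : ℂ) ^ 2)
  have hT0 : (T : ℂ) ≠ 0 := by exact_mod_cast hT.ne'
  convert! key2 using 1
  · funext m
    simp only [Function.comp_apply, Equiv.neg_apply]
    rw [← inner_conj_symm, ← fourierBasis.repr_apply_apply, ← fourierBasis.repr_apply_apply,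
      coeff, coeff]
    simp only [map_mul, map_inv₀, Complex.conj_ofReal]
    field_simp
  · field_simp

/-- Uniqueness of Fourier coefficients for integrable, not necessarily square integrable,
functions: trigonometric polynomials are uniformly dense in the continuous periodic functions, and
smooth functions supported inside the interval are among the latter. -/
theorem ae_eq_zero_of_forall_integral_mul_fourier_eq_zero {T : ℝ} (hT : 0 < T) (c : ℝ) {Φ : ℝ → ℂ}
    (hΦ : IntegrableOn Φ (Ioc c (c + T)))
    (h : ∀ m : ℤ, ∫ x in Ioc c (c + T), Φ x * fourier m (x : AddCircle T) = 0) :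
    ∀ᵐ x ∂volume.restrict (Ioc c (c + T)), Φ x = 0 := by
  have := Fact.mk hT
  have hmeas : ∀ F : C(AddCircle T, ℂ), Continuous fun x : ℝ => F (x : AddCircle T) := fun F =>
    F.continuous.comp (AddCircle.continuous_mk' T)
  have hint : ∀ F : C(AddCircle T, ℂ), Integrable (fun x : ℝ => Φ x * F (x : AddCircle T))
      (volume.restrict (Ioc c (c + T))) := fun F =>
    hΦ.mul_bdd (c := ‖F‖) (hmeas F).aestronglyMeasurable
      (Filter.Eventually.of_forall fun x => F.norm_coe_le_norm _)
  let L₀ : C(AddCircle T, ℂ) →ₗ[ℂ] ℂ :=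
    { toFun := fun F => ∫ x in Ioc c (c + T), Φ x * F (x : AddCircle T)
      map_add' := fun F G => by
        rw [← integral_add (hint F) (hint G)]
        simp [mul_add]
      map_smul' := fun r F => by
        rw [RingHom.id_apply, smul_eq_mul, ← integral_const_mul]
        simp [mul_left_comm] }
  let L : C(AddCircle T, ℂ) →L[ℂ] ℂ := L₀.mkContinuous (∫ x in Ioc c (c + T), ‖Φ x‖) fun F => by
    refine (norm_integral_le_integral_norm _).trans ?_
    rw [← integral_mul_const]
    refine integral_mono (hint F).norm (hΦ.norm.mul_const _) fun x => ?_
    simp only [norm_mul]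
    gcongr
    exact F.norm_coe_le_norm _
  have hL : L = 0 := by
    refine ContinuousLinearMap.ext_on (s := range (@fourier T)) ?_ ?_
    · have := span_fourier_closure_eq_top (T := T)
      rw [← Submodule.dense_iff_topologicalClosure_eq_top] at this
      exact this
    · rintro _ ⟨m, rfl⟩
      exact h m
  rw [← restrict_Ioo_eq_restrict_Ioc, ae_restrict_iff' measurableSet_Ioo]
  refine isOpen_Ioo.ae_eq_zero_of_integral_contDiff_smul_eq_zero
    (hΦ.mono_set Ioo_subset_Ioc_self).locallyIntegrableOn fun ψ _ _ hψ => ?_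
  have h0 : ∀ x, x ∉ Ioo c (c + T) → ψ x = 0 := fun x hx =>
    image_eq_zero_of_notMem_tsupport fun hx' => hx (hψ hx')
  let F : C(AddCircle T, ℂ) := ⟨AddCircle.liftIoc T c fun x => (ψ x : ℂ), by
    refine AddCircle.liftIoc_continuous ?_ ?_
    · rw [h0 c (by simp), h0 (c + T) (by simp)]
    · have : Continuous ψ := ContDiff.continuous ‹_›
      fun_prop⟩
  have hF : ∫ x in Ioc c (c + T), Φ x * F (x : AddCircle T) = 0 := congrArg (fun K => K F) hL
  rw [← hF, ← setIntegral_eq_integral_of_forall_compl_eq_zero (s := Ioc c (c + T))]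
  · refine setIntegral_congr_fun measurableSet_Ioc fun x hx => ?_
    have : F (x : AddCircle T) = ψ x :=
      AddCircle.liftIoc_coe_apply (f := fun x => (ψ x : ℂ)) hx
    simp only [this, Complex.real_smul, mul_comm]
  · intro x hx
    rw [h0 x fun h => hx (Ioo_subset_Ioc_self h), zero_smul]

end Fourier

/-! ### Periodization of integrable functions -/

section Periodization

open Set

theorem iUnion_Ioc_add_mul {δ : ℝ} (hδ : 0 < δ) (c : ℝ) :
    ⋃ k : ℤ, Ioc (c + k * δ) (c + k * δ + δ) = univ := by
  have := iUnion_Ioc_add_zsmul hδ c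
  simpa only [zsmul_eq_mul, Int.cast_add, Int.cast_one, add_mul, one_mul, ← add_assoc] using this

theorem pairwise_disjoint_Ioc_add_mul (c δ : ℝ) :
    Pairwise (Function.onFun Disjoint fun k : ℤ => Ioc (c + k * δ) (c + k * δ + δ)) := by
  have := pairwise_disjoint_Ioc_add_zsmul c δ
  simpa only [zsmul_eq_mul, Int.cast_add, Int.cast_one, add_mul, one_mul, ← add_assoc] using this

theorem ae_of_forall_ae_restrict_Ioc {δ : ℝ} (hδ : 0 < δ) (c : ℝ) {p : ℝ → Prop}
    (h : ∀ k : ℤ, ∀ᵐ x ∂volume.restrict (Ioc (c + k * δ) (c + k * δ + δ)), p x) :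
    ∀ᵐ x : ℝ, p x := by
  rw [← Measure.restrict_univ (μ := volume), ← iUnion_Ioc_add_mul hδ c, ae_restrict_iUnion_iff]
  exact h

/-- Integrals over the line unfold over the translates of a fundamental interval. -/
theorem hasSum_integral_translates {E : Type*} [NormedAddCommGroup E] [NormedSpace ℝ E]
    {a : ℝ} (ha : 0 < a) (c : ℝ) {f : ℝ → E} (hf : Integrable f) :
    HasSum (fun n : ℤ => ∫ x in Ioc c (c + a), f (x - n * a)) (∫ x, f x) := by
  have h := hasSum_integral_iUnion (fun k : ℤ => measurableSet_Ioc)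
    (pairwise_disjoint_Ioc_add_mul c a) hf.integrableOn
  rw [iUnion_Ioc_add_mul ha, setIntegral_univ] at h
  have h2 := (Equiv.neg ℤ).hasSum_iff.mpr h
  refine h2.congr_fun fun n => ?_
  simp only [Function.comp_apply, Equiv.neg_apply, Int.cast_neg]
  rw [← intervalIntegral.integral_of_le (by linarith), ← intervalIntegral.integral_of_le
    (by linarith), intervalIntegral.integral_comp_sub_right]
  congr 1 <;> ring

theorem summable_integral_norm_translates {E : Type*} [NormedAddCommGroup E]
    {a : ℝ} (ha : 0 < a) (c : ℝ) {f : ℝ → E} (hf : Integrable f) :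
    Summable fun n : ℤ => ∫ x in Ioc c (c + a), ‖f (x - n * a)‖ :=
  (hasSum_integral_translates ha c hf.norm).summable

theorem lintegral_tsum_enorm_ne_top {α ι : Type*} [Countable ι] [MeasurableSpace α]
    {μ : Measure α} {F : ι → α → ℂ} (hF : ∀ i, Integrable (F i) μ)
    (hs : Summable fun i => ∫ x, ‖F i x‖ ∂μ) : ∫⁻ x, ∑' i, ‖F i x‖ₑ ∂μ ≠ ⊤ := by
  rw [lintegral_tsum fun i => (hF i).1.enorm]
  simp only [← ofReal_integral_norm_eq_lintegral_enorm (hF _)]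
  exact hs.tsum_ofReal_ne_top

theorem ae_summable_of_summable_integral_norm {α ι : Type*} [Countable ι] [MeasurableSpace α]
    {μ : Measure α} {F : ι → α → ℂ} (hF : ∀ i, Integrable (F i) μ)
    (hs : Summable fun i => ∫ x, ‖F i x‖ ∂μ) : ∀ᵐ x ∂μ, Summable fun i => F i x := by
  filter_upwards [ae_lt_top' (AEMeasurable.tsum fun i => (hF i).1.enorm)
    (lintegral_tsum_enorm_ne_top hF hs)] with x hx
  exact Summable.of_nnnorm (ENNReal.tsum_coe_ne_top_iff_summable.mp hx.ne)

theorem integrable_tsum_of_summable_integral_norm {α ι : Type*} [Countable ι] [MeasurableSpace α]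
    {μ : Measure α} {F : ι → α → ℂ} (hF : ∀ i, Integrable (F i) μ)
    (hs : Summable fun i => ∫ x, ‖F i x‖ ∂μ) : Integrable (fun x => ∑' i, F i x) μ := by
  refine ⟨(AEMeasurable.tsum fun i => (hF i).1.aemeasurable).aestronglyMeasurable, ?_⟩
  exact (lintegral_mono fun x => enorm_tsum_le_tsum_enorm).trans_lt
    (lintegral_tsum_enorm_ne_top hF hs).lt_top

theorem ae_summable_translates {a : ℝ} (ha : 0 < a) {f : ℝ → ℂ} (hf : Integrable f) :
    ∀ᵐ x : ℝ, Summable fun n : ℤ => f (x - n * a) :=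
  ae_of_forall_ae_restrict_Ioc ha 0 fun _ =>
    ae_summable_of_summable_integral_norm (fun n => (hf.comp_sub_right (n * a)).integrableOn)
      (summable_integral_norm_translates ha _ hf)

theorem integrable_tsum_translates {a : ℝ} (ha : 0 < a) (c : ℝ) {f : ℝ → ℂ} (hf : Integrable f) :
    IntegrableOn (fun x => ∑' n : ℤ, f (x - n * a)) (Ioc c (c + a)) :=
  integrable_tsum_of_summable_integral_norm (fun n => (hf.comp_sub_right (n * a)).integrableOn)
    (summable_integral_norm_translates ha c hf)

theorem hasSum_setIntegral_translates {a : ℝ} (ha : 0 < a) {c : ℝ} {f : ℝ → ℂ} (hf : Integrable f)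
    {s : Set ℝ} (hs : s ⊆ Ioc c (c + a)) :
    HasSum (fun n : ℤ => ∫ x in s, f (x - n * a)) (∫ x in s, ∑' n : ℤ, f (x - n * a)) := by
  refine hasSum_integral_of_summable_integral_norm
    (fun n => (hf.comp_sub_right (n * a)).integrableOn) ?_
  refine (summable_integral_norm_translates ha c hf).of_nonneg_of_le
    (fun n => integral_nonneg fun _ => norm_nonneg _) fun n => ?_
  exact setIntegral_mono_set (hf.comp_sub_right (n * a)).norm.integrableOn
    (Filter.Eventually.of_forall fun _ => norm_nonneg _) hs.eventuallyLE

theorem fourier_coe_sub_mul {a : ℝ} (m n : ℤ) (x : ℝ) :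
    fourier m ((x - n * a : ℝ) : AddCircle a) = fourier m (x : AddCircle a) := by
  have : ((x - n * a : ℝ) : AddCircle a) = x := by
    rw [AddCircle.coe_sub, ← zsmul_eq_mul, AddCircle.coe_zsmul, AddCircle.coe_period, smul_zero,
      sub_zero]
  rw [this]

theorem integrable_mul_fourier {a : ℝ} (ha : 0 < a) {f : ℝ → ℂ} {μ : Measure ℝ}
    (hf : Integrable f μ) (m : ℤ) : Integrable (fun x => f x * fourier m (x : AddCircle a)) μ := by
  have := Fact.mk ha
  refine hf.mul_bdd (c := 1) ?_ ?_
  · exact ((fourier m).continuous.comp (AddCircle.continuous_mk' a)).aestronglyMeasurable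
  · refine Filter.Eventually.of_forall fun x => ?_
    exact ((fourier m).norm_coe_le_norm _).trans (fourier_norm m).le

theorem setIntegral_tsum_translates_mul_fourier {a : ℝ} (ha : 0 < a) (c : ℝ) {f : ℝ → ℂ}
    (hf : Integrable f) (m : ℤ) :
    ∫ x in Ioc c (c + a), (∑' n : ℤ, f (x - n * a)) * fourier m (x : AddCircle a) =
      ∫ x, f x * fourier m (x : AddCircle a) := by
  have hF := integrable_mul_fourier ha hf m
  rw [← (hasSum_setIntegral_translates ha hF subset_rfl).unique
    (hasSum_integral_translates ha c hF)]
  simp only [fourier_coe_sub_mul, tsum_mul_right]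

theorem setIntegral_const_mul_fourier {a : ℝ} (ha : 0 < a) (c : ℝ) (w : ℂ) (m : ℤ) :
    ∫ x in Ioc c (c + a), w * fourier m (x : AddCircle a) = if m = 0 then a * w else 0 := by
  have := Fact.mk ha
  have h := fourierCoeff_eq_intervalIntegral (T := a) (fourier 0) (-m) c
  rw [fourierCoeff_fourier, intervalIntegral.integral_of_le (by linarith)] at h
  simp only [neg_neg, fourier_zero, smul_eq_mul, mul_one, Complex.real_smul] at h
  have ha' : (a : ℂ) ≠ 0 := by exact_mod_cast ha.ne'
  rw [integral_const_mul]
  have h2 : ∫ x in Ioc c (c + a), fourier m (x : AddCircle a) =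
      a * Pi.single (M := fun _ : ℤ => ℂ) 0 1 (-m) := by
    rw [h]
    push_cast
    field_simp
  rw [h2, Pi.single_apply]
  simp only [neg_eq_zero]
  split_ifs <;> ring

/-- An integrable function has constant periodization exactly when its Fourier transform vanishes
at the nonzero points of the dual lattice and has the corresponding value at the origin. The left
side includes absolute convergence, which is automatic for integrable functions. -/
theorem ae_hasSum_translates_iff {a : ℝ} (ha : 0 < a) {f : ℝ → ℂ} (hf : Integrable f) (w : ℂ) :
    (∀ᵐ x : ℝ, HasSum (fun n : ℤ => f (x - n * a)) w) ↔
      ∀ m : ℤ, ∫ x, f x * fourier m (x : AddCircle a) = if m = 0 then a * w else 0 := by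
  constructor
  · intro h m
    rw [← setIntegral_tsum_translates_mul_fourier ha 0 hf, ← setIntegral_const_mul_fourier ha 0]
    refine setIntegral_congr_ae measurableSet_Ioc ?_
    filter_upwards [h] with x hx _
    rw [hx.tsum_eq]
  · intro h
    refine ae_of_forall_ae_restrict_Ioc ha 0 fun k => ?_
    have hint := integrable_tsum_translates ha (0 + k * a) hf
    have hw : IntegrableOn (fun _ : ℝ => w) (Ioc (0 + k * a) (0 + k * a + a)) := by simp
    have := ae_eq_zero_of_forall_integral_mul_fourier_eq_zero ha (0 + k * a) (hint.sub hw) fun m => by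
      simp only [Pi.sub_apply, sub_mul]
      rw [integral_sub (integrable_mul_fourier ha hint m) (integrable_mul_fourier ha hw m),
        setIntegral_tsum_translates_mul_fourier ha _ hf, setIntegral_const_mul_fourier ha, h,
        sub_self]
    filter_upwards [this, ae_restrict_of_ae (ae_summable_translates ha hf)] with x hx hs
    rw [Pi.sub_apply, sub_eq_zero] at hx
    rw [← hx]
    exact hs.hasSum

end Periodization

/-! ### Frames and dual systems in a Hilbert space -/

section AbstractFrames

variable {ι H : Type*} [NormedAddCommGroup H] [InnerProductSpace ℂ H]

theorem IsFrame.hasUpperFrameBound {f : ι → H} (hf : IsFrame f) : HasUpperFrameBound f := by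
  obtain ⟨A, B, -, hB, h⟩ := hf
  exact ⟨B, hB, fun x => ⟨(h x).1, (h x).2.2⟩⟩

theorem norm_sq_eq_tsum_of_lp (y : lp (fun _ : ι => ℂ) 2) : ‖y‖ ^ 2 = ∑' i, ‖y i‖ ^ 2 := by
  simpa using lp.norm_rpow_eq_tsum (p := 2) (by norm_num) y

/-- The analysis operator needs the upper frame bound only. -/
theorem HasUpperFrameBound.exists_analysis {f : ι → H} (hf : HasUpperFrameBound f) :
    ∃ T : H →L[ℂ] lp (fun _ : ι => ℂ) 2, ∀ x i, T x i = inner ℂ (f i) x := by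
  obtain ⟨B, hB, h⟩ := hf
  have hmem : ∀ x : H, Memℓp (fun i => inner ℂ (f i) x) 2 := fun x =>
    memℓp_gen (by simpa using (h x).1)
  let T₀ : H →ₗ[ℂ] lp (fun _ : ι => ℂ) 2 :=
    { toFun := fun x => ⟨fun i => inner ℂ (f i) x, hmem x⟩
      map_add' := fun x y => by
        ext i
        exact inner_add_right _ _ _
      map_smul' := fun c x => by
        ext i
        exact inner_smul_right _ _ _ }
  refine ⟨T₀.mkContinuous (Real.sqrt B) fun x => ?_, fun _ _ => rfl⟩
  refine abs_le_of_sq_le_sq' ?_ (by positivity) |>.2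
  rw [norm_sq_eq_tsum_of_lp, mul_pow, Real.sq_sqrt hB.le]
  exact (h x).2

variable [CompleteSpace H]

/-- The synthesis series of `ℓ²` coefficients converges unconditionally, being the image under the
adjoint of the analysis operator of the expansion of `y` in unit vectors. -/
theorem HasUpperFrameBound.exists_synthesis {f : ι → H} (hf : HasUpperFrameBound f) :
    ∃ R : lp (fun _ : ι => ℂ) 2 →L[ℂ] H, ∀ y, HasSum (fun i => y i • f i) (R y) := by
  classical
  obtain ⟨T, hT⟩ := hf.exists_analysis
  refine ⟨T.adjoint, fun y => ?_⟩
  have hadj : ∀ (i : ι) (c : ℂ), T.adjoint (lp.single 2 i c) = c • f i := fun i c => by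
    refine ext_inner_left ℂ fun x => ?_
    rw [ContinuousLinearMap.adjoint_inner_right, lp.inner_single_right, hT, inner_smul_right]
    simp
  simpa only [hadj] using (lp.hasSum_single (p := 2) (by norm_num) y).mapL T.adjoint

/-- The mixed frame operator `x ↦ ∑ ⟨x, h i⟩ f i` of two systems with upper frame bounds. -/
theorem HasUpperFrameBound.exists_mixedOperator {h f : ι → H} (hh : HasUpperFrameBound h)
    (hf : HasUpperFrameBound f) :
    ∃ K : H →L[ℂ] H, ∀ x, HasSum (fun i => inner ℂ (h i) x • f i) (K x) := by
  obtain ⟨T, hT⟩ := hh.exists_analysis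
  obtain ⟨R, hR⟩ := hf.exists_synthesis
  exact ⟨R ∘L T, fun x => by
    simpa only [hT, ContinuousLinearMap.comp_apply] using hR (T x)⟩

/-- Once the reconstruction formula holds, the lower frame bound of `h` is automatic: the synthesis
operator of `f` is a bounded left inverse of the analysis operator of `h`. -/
theorem HasUpperFrameBound.isAlternateDualFrame {h f : ι → H} (hh : HasUpperFrameBound h)
    (hf : HasUpperFrameBound f) (H1 : ∀ x : H, HasSum (fun i => inner ℂ (h i) x • f i) x) :
    IsAlternateDualFrame h f := by
  refine ⟨?_, H1⟩
  obtain ⟨T, hT⟩ := hh.exists_analysis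
  obtain ⟨R, hR⟩ := hf.exists_synthesis
  obtain ⟨B, hB, hB'⟩ := hh
  have hRT : ∀ x, R (T x) = x := fun x =>
    (hR (T x)).unique (by simpa only [hT] using H1 x)
  -- `‖R‖ + 1` in place of `‖R‖` keeps the lower bound positive when `R = 0`,
  -- where the inverse would take the junk value `0`.
  refine ⟨((‖R‖ + 1) ^ 2)⁻¹, B, by positivity, hB, fun x => ⟨(hB' x).1, ?_, (hB' x).2⟩⟩
  have h1 : ‖x‖ ≤ (‖R‖ + 1) * ‖T x‖ := by
    have := R.le_opNorm (T x)
    rw [hRT] at this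
    nlinarith [norm_nonneg (T x)]
  have h2 : ‖x‖ ^ 2 ≤ (‖R‖ + 1) ^ 2 * ‖T x‖ ^ 2 := by
    rw [← mul_pow]
    gcongr
  simp only [← hT, ← norm_sq_eq_tsum_of_lp]
  rwa [inv_mul_le_iff₀ (by positivity)]

theorem IsFrame.hasSum_frameOperator {f : ι → H} (hf : IsFrame f) (x : H) :
    HasSum (fun i => inner ℂ (f i) x • f i) (frameOperator f x) := by
  obtain ⟨K, hK⟩ := hf.hasUpperFrameBound.exists_mixedOperator hf.hasUpperFrameBound
  exact (hK x).summable.hasSum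

theorem IsFrame.inner_frameOperator_right {f : ι → H} (hf : IsFrame f) (x y : H) :
    inner ℂ x (frameOperator f y) = inner ℂ (frameOperator f x) y := by
  have h1 := (hf.hasSum_frameOperator y).mapL (innerSL ℂ x)
  have h2 := ((hf.hasSum_frameOperator x).mapL (innerSL ℂ y)).star
  simp only [innerSL_apply_apply, RCLike.star_def, inner_conj_symm] at h1 h2
  refine h1.unique ?_
  convert h2 using 1
  funext i
  simp only [inner_smul_left, inner_smul_right, inner_conj_symm, mul_comm]

/-- The system `S⁻¹ f i` reconstructs every `x`: this is the frame expansion of `S (S⁻¹ x)`,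
rewritten with the self-adjointness of `S`. -/
theorem IsFrame.hasSum_canonicalDual {f : ι → H} (hf : IsFrame f) (x : H) :
    HasSum (fun i => inner ℂ (hf.frameOperatorEquiv.symm (f i)) x • f i) x := by
  have hS : ∀ y, frameOperator f (hf.frameOperatorEquiv.symm y) = y :=
    hf.frameOperatorEquiv.apply_symm_apply
  have h := hf.hasSum_frameOperator (hf.frameOperatorEquiv.symm x)
  rw [hS] at h
  refine h.congr_fun fun i => ?_
  conv_lhs => rw [← hS x, hf.inner_frameOperator_right, hS]

/-- The frame operator commutes with every isometry that permutes the frame up to unimodular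
factors. -/
theorem IsFrame.frameOperator_comm {f : ι → H} (hf : IsFrame f) (U : H →ₗᵢ[ℂ] H) (σ : ι ≃ ι)
    {z : ι → ℂ} (hz : ∀ i, ‖z i‖ = 1) (hU : ∀ i, U (f i) = z i • f (σ i)) (x : H) :
    frameOperator f (U x) = U (frameOperator f x) := by
  have h1 := σ.hasSum_iff.mpr (hf.hasSum_frameOperator (U x))
  refine h1.unique (((hf.hasSum_frameOperator x).mapL U.toContinuousLinearMap).congr_fun
    fun i => ?_)
  have hzz : starRingEnd ℂ (z i) * z i = 1 := by
    rw [mul_comm, Complex.mul_conj, Complex.normSq_eq_norm_sq, hz]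
    simp
  have : inner ℂ (f i) x = starRingEnd ℂ (z i) * inner ℂ (f (σ i)) (U x) := by
    rw [← U.inner_map_map, hU, inner_smul_left]
  simp only [Function.comp_apply, LinearIsometry.coe_toContinuousLinearMap, map_smul, hU, this,
    smul_smul]
  rw [mul_right_comm, hzz, one_mul]

end AbstractFrames

/-! ### Translations and modulations on `L²(ℝ)` -/

section TimeFrequency

theorem coeFn_translate (c : ℝ) (f : L2) :
    translate c f =ᵐ[volume] fun x => f (x - c) :=
  Lp.coeFn_compMeasurePreserving f (measurePreserving_sub_right volume c)

theorem coeFn_modulate (c : ℝ) (f : L2) :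
    modulate c f =ᵐ[volume] fun x => Complex.exp (2 * Real.pi * Complex.I * c * x) * f x :=
  (memLp_modulate c f).coeFn_toLp

theorem ae_comp_sub {p : ℝ → Prop} (h : ∀ᵐ x : ℝ, p x) (c : ℝ) : ∀ᵐ x : ℝ, p (x - c) :=
  (measurePreserving_sub_right volume c).quasiMeasurePreserving.ae h

theorem coeFn_modulate_translate (c d : ℝ) (f : L2) :
    modulate c (translate d f) =ᵐ[volume]
      fun x => Complex.exp (2 * Real.pi * Complex.I * c * x) * f (x - d) := by
  filter_upwards [coeFn_modulate c (translate d f), coeFn_translate d f] with x h1 h2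
  rw [h1, h2]

theorem norm_exp_two_pi_mul (c x : ℝ) : ‖Complex.exp (2 * Real.pi * Complex.I * c * x)‖ = 1 := by
  rw [show (2 * Real.pi * Complex.I * c * x : ℂ) =
    ((2 * Real.pi * c * x : ℝ) : ℂ) * Complex.I by push_cast; ring,
    Complex.norm_exp_ofReal_mul_I]

/-- The time-frequency shift `E_c T_d` as a linear isometry of `L²(ℝ)`. -/
def timeFrequencyShift (c d : ℝ) : L2 →ₗᵢ[ℂ] L2 where
  toFun f := modulate c (translate d f)
  map_add' f g := by
    apply Lp.ext
    filter_upwards [coeFn_modulate_translate c d (f + g), coeFn_modulate_translate c d f,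
      coeFn_modulate_translate c d g, ae_comp_sub (Lp.coeFn_add f g) d,
      Lp.coeFn_add (modulate c (translate d f)) (modulate c (translate d g))] with x h1 h2 h3 h4 h5
    rw [h1, h4, h5, Pi.add_apply, Pi.add_apply, h2, h3, mul_add]
  map_smul' r f := by
    apply Lp.ext
    filter_upwards [coeFn_modulate_translate c d (r • f), coeFn_modulate_translate c d f,
      ae_comp_sub (Lp.coeFn_smul r f) d,
      Lp.coeFn_smul r (modulate c (translate d f))] with x h1 h2 h3 h4
    rw [h1, h3, RingHom.id_apply, h4, Pi.smul_apply, Pi.smul_apply, h2, smul_eq_mul, smul_eq_mul,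
      mul_left_comm]
  norm_map' f := by
    have h1 : ‖modulate c (translate d f)‖ = ‖translate d f‖ := by
      refine le_antisymm (Lp.norm_le_norm_of_ae_le ?_) (Lp.norm_le_norm_of_ae_le ?_) <;>
      · filter_upwards [coeFn_modulate c (translate d f)] with x hx
        rw [hx, norm_mul, norm_exp_two_pi_mul, one_mul]
    exact h1.trans (Lp.norm_compMeasurePreserving f _)

theorem timeFrequencyShift_apply (c d : ℝ) (f : L2) :
    timeFrequencyShift c d f = modulate c (translate d f) := rfl

/-- Time-frequency shifts compose up to a phase, the commutation relation of the Weyl-Heisenberg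
group. -/
theorem timeFrequencyShift_comp (c d c' d' : ℝ) (f : L2) :
    timeFrequencyShift c d (timeFrequencyShift c' d' f) =
      Complex.exp (2 * Real.pi * Complex.I * (-c' : ℝ) * d) •
        timeFrequencyShift (c + c') (d + d') f := by
  simp only [timeFrequencyShift_apply]
  apply Lp.ext
  filter_upwards [coeFn_modulate_translate c d (modulate c' (translate d' f)),
    ae_comp_sub (coeFn_modulate_translate c' d' f) d,
    Lp.coeFn_smul (Complex.exp (2 * Real.pi * Complex.I * (-c' : ℝ) * d))
      (modulate (c + c') (translate (d + d') f)),
    coeFn_modulate_translate (c + c') (d + d') f] with x h1 h2 h3 h4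
  rw [h1, h2, h3, Pi.smul_apply, h4, smul_eq_mul, ← mul_assoc, ← mul_assoc, ← Complex.exp_add,
    ← Complex.exp_add, sub_sub]
  congr 2
  push_cast
  ring

/-- The canonical dual of a Weyl-Heisenberg frame is the Weyl-Heisenberg system of `S⁻¹ g`. -/
theorem IsFrame.whSystem_symm_frameOperator {a b : ℝ} {g : L2} (hg : IsFrame (whSystem a b g))
    (p : ℤ × ℤ) : whSystem a b (hg.frameOperatorEquiv.symm g) p =
      hg.frameOperatorEquiv.symm (whSystem a b g p) := by
  rw [Equiv.eq_symm_apply]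
  have hcomm := hg.frameOperator_comm (timeFrequencyShift (p.1 * b) (p.2 * a)) (Equiv.addLeft p)
    (z := fun q => Complex.exp (2 * Real.pi * Complex.I * (-(q.1 * b) : ℝ) * (p.2 * a : ℝ)))
    (fun q => norm_exp_two_pi_mul _ _) (fun q => by
      change timeFrequencyShift _ _ (timeFrequencyShift (q.1 * b) (q.2 * a) g) =
        _ • timeFrequencyShift (((p + q).1 : ℤ) * b) (((p + q).2 : ℤ) * a) g
      rw [timeFrequencyShift_comp, Prod.fst_add, Prod.snd_add, Int.cast_add, Int.cast_add,
        add_mul, add_mul]) (hg.frameOperatorEquiv.symm g)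
  have hS : frameOperator (whSystem a b g) (hg.frameOperatorEquiv.symm g) = g :=
    hg.frameOperatorEquiv.apply_symm_apply g
  rw [hS] at hcomm
  exact hcomm

theorem IsFrame.hasSum_whSystem_canonicalDual {a b : ℝ} {g : L2} (hg : IsFrame (whSystem a b g))
    (x : L2) : HasSum (fun p => inner ℂ (whSystem a b (hg.frameOperatorEquiv.symm g) p) x •
      whSystem a b g p) x := by
  simp only [hg.whSystem_symm_frameOperator]
  exact hg.hasSum_canonicalDual x

end TimeFrequency

/-! ### Testing against indicator functions -/

section Indicators

open Set

/-- The indicator function of a measurable subset of a bounded interval, as an element of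
`L²(ℝ)`. -/
def indicatorL2 {s : Set ℝ} (hs : MeasurableSet s) {c d : ℝ} (hsub : s ⊆ Ioc c d) : L2 :=
  indicatorConstLp 2 hs (measure_ne_top_of_subset hsub measure_Ioc_lt_top.ne) 1

theorem inner_indicatorL2_left {s : Set ℝ} (hs : MeasurableSet s) {c d : ℝ} (hsub : s ⊆ Ioc c d)
    (f : L2) : inner ℂ (indicatorL2 hs hsub) f = ∫ x in s, f x :=
  L2.inner_indicatorConstLp_one hs _ f

theorem setIntegral_indicatorL2 {s t : Set ℝ} (hs : MeasurableSet s) {c d : ℝ}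
    (hsub : s ⊆ Ioc c d) :
    ∫ x in t, indicatorL2 hs hsub x = (volume.real (s ∩ t) : ℂ) := by
  have h : ∫ x in t, indicatorL2 hs hsub x = ∫ x in t, s.indicator (fun _ => (1 : ℂ)) x :=
    integral_congr_ae (ae_restrict_of_ae indicatorConstLp_coeFn)
  rw [h, integral_indicator_const _ hs, measureReal_restrict_apply hs, Complex.real_smul, mul_one]

/-- An element of `L²(ℝ)` vanishes if it is orthogonal to the indicator functions supported in the
intervals of one tiling. -/
theorem eq_zero_of_forall_inner_indicatorL2 {δ : ℝ} (hδ : 0 < δ) (c : ℝ) {z : L2}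
    (h : ∀ (k : ℤ) (s : Set ℝ) (hs : MeasurableSet s)
      (hsub : s ⊆ Ioc (c + k * δ) (c + k * δ + δ)), inner ℂ (indicatorL2 hs hsub) z = 0) :
    z = 0 := by
  rw [Lp.eq_zero_iff_ae_eq_zero]
  refine ae_of_forall_ae_restrict_Ioc hδ c fun k => ?_
  have hz : Integrable z (volume.restrict (Ioc (c + k * δ) (c + k * δ + δ))) :=
    ((Lp.memLp z).restrict _).integrable (by norm_num)
  refine hz.ae_eq_zero_of_forall_setIntegral_eq_zero fun s hs _ => ?_
  rw [Measure.restrict_restrict hs]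
  rw [← inner_indicatorL2_left (hs.inter measurableSet_Ioc) inter_subset_right]
  exact h k _ _ _

end Indicators

/-! ### The Weyl-Heisenberg frame identity -/

section FrameIdentity

open Set

theorem coeFn_whSystem (a b : ℝ) (g : L2) (m n : ℤ) :
    whSystem a b g (m, n) =ᵐ[volume]
      fun x => g (x - n * a) * fourier m (x : AddCircle (1 / b)) := by
  filter_upwards [coeFn_modulate_translate (m * b) (n * a) g] with x hx
  rw [whSystem, hx, fourier_coe_apply, mul_comm]
  congr 2
  push_cast
  rw [div_div_eq_mul_div, div_one]
  ring

theorem integrable_mul_conj_translate (h g : L2) (d : ℝ) :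
    Integrable fun x => h x * starRingEnd ℂ (g (x - d)) := by
  refine (L2.integrable_inner (𝕜 := ℂ) (translate d g) h).congr ?_
  filter_upwards [coeFn_translate d g] with x hx
  rw [RCLike.inner_apply, hx]

theorem memLp_indicator_translate (g : L2) (d : ℝ) {s : Set ℝ} (hs : MeasurableSet s)
    (μ : Measure ℝ) (hμ : μ ≤ volume) :
    MemLp (s.indicator fun x => g (x - d)) 2 μ :=
  (((Lp.memLp g).comp_measurePreserving (measurePreserving_sub_right volume d)).indicator
    hs).mono_measure hμ

theorem setIntegral_eq_setIntegral_preimage_sub {t : Set ℝ} (ht : MeasurableSet t) (F : ℝ → ℂ)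
    (d : ℝ) : ∫ x in t, F x = ∫ x in (fun x => x - d) ⁻¹' t, F (x - d) := by
  rw [← integral_indicator ht, ← integral_indicator (ht.preimage (measurable_sub_const d)),
    ← integral_sub_right_eq_self _ d]
  rfl

/-- Parseval's identity in the modulation index `m`. Shifting `t` by `k / b`, a multiple of the
period of the characters, brings both indicator functions into one period. -/
theorem hasSum_inner_mul_inner_modulations {a b : ℝ} (hb : 0 < b) (g h : L2) {c d : ℝ} (k n : ℤ)
    {s t : Set ℝ} (hs : MeasurableSet s) (ht : MeasurableSet t) (hsub : s ⊆ Ioc c d)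
    (hd : d ≤ c + 1 / b) (htub : t ⊆ Ioc (c - k / b) (c - k / b + 1 / b)) :
    HasSum (fun m : ℤ => inner ℂ (indicatorL2 hs hsub) (whSystem a b h (m, n)) *
        inner ℂ (whSystem a b g (m, n)) (indicatorL2 ht htub))
      (1 / b * ∫ x in s ∩ (fun x => x - k / b) ⁻¹' t,
        h (x - n * a) * starRingEnd ℂ (g (x - n * a - k / b))) := by
  set t' := (fun x : ℝ => x - k / b) ⁻¹' t with ht'
  have ht'm : MeasurableSet t' := ht.preimage (measurable_sub_const _)
  have hs' : s ⊆ Ioc c (c + 1 / b) := hsub.trans (Ioc_subset_Ioc_right hd)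
  have ht's : t' ⊆ Ioc c (c + 1 / b) := fun x hx => by
    have := htub hx
    simp only [mem_Ioc] at this ⊢
    constructor <;> linarith [this.1, this.2]
  have hP := hasSum_parseval_interval (T := 1 / b) (by positivity) c
    (memLp_indicator_translate h (n * a) hs _ Measure.restrict_le_self)
    (memLp_indicator_translate g (n * a + k / b) ht'm _ Measure.restrict_le_self)
  have hint : ∀ (F : ℝ → ℂ) {r : Set ℝ}, MeasurableSet r → r ⊆ Ioc c (c + 1 / b) → ∀ m : ℤ,
      ∫ x in Ioc c (c + 1 / b), r.indicator F x * fourier m (x : AddCircle (1 / b)) =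
        ∫ x in r, F x * fourier m (x : AddCircle (1 / b)) := fun F r hr hrs m => by
    have : ∀ x : ℝ, r.indicator F x * fourier m (x : AddCircle (1 / b)) =
        r.indicator (fun x => F x * fourier m (x : AddCircle (1 / b))) x := fun x =>
      (indicator_mul_left r F fun x => fourier m (x : AddCircle (1 / b))).symm
    simp only [this]
    rw [setIntegral_indicator hr, inter_eq_right.mpr hrs]
  have e1 : ∀ m : ℤ, inner ℂ (indicatorL2 hs hsub) (whSystem a b h (m, n)) =
      ∫ x in s, h (x - n * a) * fourier m (x : AddCircle (1 / b)) := fun m => by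
    rw [inner_indicatorL2_left]
    exact integral_congr_ae (ae_restrict_of_ae (coeFn_whSystem a b h m n))
  have e2 : ∀ m : ℤ, inner ℂ (indicatorL2 ht htub) (whSystem a b g (m, n)) =
      ∫ x in t', g (x - (n * a + k / b)) * fourier m (x : AddCircle (1 / b)) := fun m => by
    rw [inner_indicatorL2_left, integral_congr_ae (ae_restrict_of_ae (coeFn_whSystem a b g m n)),
      setIntegral_eq_setIntegral_preimage_sub ht _ (k / b)]
    refine integral_congr_ae (Filter.Eventually.of_forall fun x => ?_)
    have h1 := fourier_coe_sub_mul (a := 1 / b) m k x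
    rw [mul_one_div] at h1
    simp only [h1, sub_sub, add_comm]
  convert! hP using 1
  · funext m
    rw [hint _ hs hs', hint _ ht'm ht's, e1, ← inner_conj_symm, e2]
  · push_cast
    congr 1
    have : ∀ x, s.indicator (fun x => h (x - n * a)) x *
        starRingEnd ℂ (t'.indicator (fun x => g (x - (n * a + k / b))) x) =
        (s ∩ t').indicator
          (fun x => h (x - n * a) * starRingEnd ℂ (g (x - n * a - k / b))) x := fun x => by
      by_cases h1 : x ∈ s <;> by_cases h2 : x ∈ t' <;> simp [h1, h2, sub_sub]
    simp only [this]
    rw [setIntegral_indicator (hs.inter ht'm), inter_eq_right.mpr (inter_subset_left.trans hs')]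

/-- The Weyl-Heisenberg frame identity, localized: when `s` lies in one period `1 / b` and `t` in
its shift by `-k / b`, only the `k`-th correlation of `g` and `h` contributes. That `s` also lies
in one period `a` makes the sum over the translations `n` absolutely convergent. -/
theorem eq_setIntegral_of_hasSum_inner_mul_inner {a b : ℝ} (ha : 0 < a) (hb : 0 < b) (g h : L2)
    {c d : ℝ} (k : ℤ) {s t : Set ℝ} (hs : MeasurableSet s) (ht : MeasurableSet t)
    (hsub : s ⊆ Ioc c d) (hda : d ≤ c + a) (hd : d ≤ c + 1 / b)
    (htub : t ⊆ Ioc (c - k / b) (c - k / b + 1 / b)) {S : ℂ}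
    (hS : HasSum (fun p : ℤ × ℤ => inner ℂ (indicatorL2 hs hsub) (whSystem a b h p) *
      inner ℂ (whSystem a b g p) (indicatorL2 ht htub)) S) :
    S = 1 / b * ∫ x in s ∩ (fun x => x - k / b) ⁻¹' t,
      ∑' n : ℤ, h (x - n * a) * starRingEnd ℂ (g (x - n * a - k / b)) := by
  have h1 := ((Equiv.prodComm ℤ ℤ).hasSum_iff.mpr hS).prod_fiberwise fun n =>
    hasSum_inner_mul_inner_modulations (a := a) hb g h k n hs ht hsub hd htub
  exact h1.unique ((hasSum_setIntegral_translates ha (integrable_mul_conj_translate h g (k / b))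
    (inter_subset_left.trans (hsub.trans (Ioc_subset_Ioc_right hda)))).mul_left _)

/-- For `k ≠ 0` the sets `s` and `t` lie in different tiles of length `1 / b`. -/
theorem inner_indicatorL2_indicatorL2_eq_ite {b : ℝ} {c d : ℝ} (k : ℤ) {s t : Set ℝ}
    (hs : MeasurableSet s) (ht : MeasurableSet t) (hsub : s ⊆ Ioc c d) (hd : d ≤ c + 1 / b)
    (htub : t ⊆ Ioc (c - k / b) (c - k / b + 1 / b)) :
    inner ℂ (indicatorL2 hs hsub) (indicatorL2 ht htub) =
      if k = 0 then (volume.real (s ∩ (fun x => x - k / b) ⁻¹' t) : ℂ) else 0 := by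
  rw [inner_indicatorL2_left, setIntegral_indicatorL2, inter_comm]
  split_ifs with hk
  · simp [hk]
  · have hdisj : s ∩ t = ∅ := by
      have := pairwise_disjoint_Ioc_add_mul c (1 / b) (i := 0) (j := -k) (by simpa [eq_comm] using hk)
      refine (Disjoint.mono ?_ ?_ this).inter_eq
      · simpa using hsub.trans (Ioc_subset_Ioc_right hd)
      · simpa [div_eq_mul_inv, ← sub_eq_add_neg] using htub
    rw [hdisj]
    simp

end FrameIdentity

/-! ### Duality through correlations -/

section Duality

open Set

/-- The reconstruction formula determines the correlations of `g` and `h`. No frame bound for `h`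
is needed, so this applies to the canonical dual as it stands. -/
theorem ae_hasSum_correlation_of_hasSum {a b : ℝ} (ha : 0 < a) (hb : 0 < b) {g h : L2}
    (H : ∀ x : L2, HasSum (fun p => inner ℂ (whSystem a b h p) x • whSystem a b g p) x) (k : ℤ) :
    ∀ᵐ x : ℝ, HasSum (fun n : ℤ => h (x - n * a) * starRingEnd ℂ (g (x - n * a - k / b)))
      (if k = 0 then (b : ℂ) else 0) := by
  have hb' : (b : ℂ) ≠ 0 := by exact_mod_cast hb.ne'
  -- Intervals of length `δ` lie in a single period of both lattices, `a ℤ` and `b⁻¹ ℤ`.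
  set δ := min a (1 / b) with hδ
  have hδ0 : 0 < δ := lt_min ha (by positivity)
  have hφ := integrable_mul_conj_translate h g (k / b)
  refine ae_of_forall_ae_restrict_Ioc hδ0 0 fun j => ?_
  set c := 0 + j * δ with hc
  have hca : c + δ ≤ c + a := by linarith [min_le_left a (1 / b)]
  have hcb : c + δ ≤ c + 1 / b := by linarith [min_le_right a (1 / b)]
  have hint : IntegrableOn (fun x => ∑' n : ℤ,
      h (x - n * a) * starRingEnd ℂ (g (x - n * a - k / b))) (Ioc c (c + δ)) :=
    (integrable_tsum_translates ha c hφ).mono_set (Ioc_subset_Ioc_right hca)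
  have hconst : IntegrableOn (fun _ : ℝ => if k = 0 then (b : ℂ) else 0) (Ioc c (c + δ)) := by
    simp
  have key := hint.ae_eq_of_forall_setIntegral_eq _ _ hconst fun s hs _ => by
    rw [Measure.restrict_restrict hs]
    have hs' := hs.inter (measurableSet_Ioc (a := c) (b := c + δ))
    generalize hr : s ∩ Ioc c (c + δ) = r at hs' ⊢
    have hsub : r ⊆ Ioc c (c + δ) := hr ▸ inter_subset_right
    have ht : MeasurableSet (Ioc (c - k / b) (c - k / b + 1 / b)) := measurableSet_Ioc
    have h1 := ((H (indicatorL2 hs' hsub)).mapL (innerSL ℂ (indicatorL2 ht subset_rfl))).star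
    have h2 : HasSum (fun p : ℤ × ℤ => inner ℂ (indicatorL2 hs' hsub) (whSystem a b h p) *
        inner ℂ (whSystem a b g p) (indicatorL2 ht subset_rfl))
        (inner ℂ (indicatorL2 hs' hsub) (indicatorL2 ht subset_rfl)) := by
      simpa only [innerSL_apply_apply, inner_smul_right, RCLike.star_def, map_mul,
        inner_conj_symm] using h1
    have h3 := eq_setIntegral_of_hasSum_inner_mul_inner ha hb g h k hs' ht hsub hca hcb
      subset_rfl h2
    have hpre : r ∩ (fun x => x - k / b) ⁻¹' Ioc (c - k / b) (c - k / b + 1 / b) = r := by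
      refine inter_eq_left.mpr fun x hx => ?_
      have := hsub hx
      simp only [mem_preimage, mem_Ioc] at this ⊢
      constructor <;> linarith [this.1, this.2]
    rw [inner_indicatorL2_indicatorL2_eq_ite k hs' ht hsub hcb, hpre] at h3
    rw [setIntegral_const, Complex.real_smul, ← mul_right_inj' (one_div_ne_zero hb'), ← h3]
    split_ifs
    · field_simp
    · simp
  filter_upwards [key, ae_restrict_of_ae (ae_summable_translates ha hφ)] with x hx hs
  rw [← hx]
  exact hs.hasSum

/-- Conversely, the correlations determine the mixed frame operator `K` on indicator functions, and
these are total. -/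
theorem hasSum_of_ae_hasSum_correlation {a b : ℝ} (ha : 0 < a) (hb : 0 < b) {g h : L2}
    (hg : HasUpperFrameBound (whSystem a b g)) (hh : HasUpperFrameBound (whSystem a b h))
    (H : ∀ k : ℤ, ∀ᵐ x : ℝ,
      HasSum (fun n : ℤ => h (x - n * a) * starRingEnd ℂ (g (x - n * a - k / b)))
        (if k = 0 then (b : ℂ) else 0)) (x : L2) :
    HasSum (fun p => inner ℂ (whSystem a b h p) x • whSystem a b g p) x := by
  have hb' : (b : ℂ) ≠ 0 := by exact_mod_cast hb.ne'
  obtain ⟨K, hK⟩ := hh.exists_mixedOperator hg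
  set δ := min a (1 / b) with hδ
  have hδ0 : 0 < δ := lt_min ha (by positivity)
  have hKs : ∀ (j : ℤ) (s : Set ℝ) (hs : MeasurableSet s)
      (hsub : s ⊆ Ioc (0 + j * δ) (0 + j * δ + δ)),
      K (indicatorL2 hs hsub) = indicatorL2 hs hsub := fun j s hs hsub => by
    set c := 0 + j * δ with hc
    have hca : c + δ ≤ c + a := by linarith [min_le_left a (1 / b)]
    have hcb : c + δ ≤ c + 1 / b := by linarith [min_le_right a (1 / b)]
    rw [← sub_eq_zero]
    -- The tiling by intervals of length `1 / b` starts at the left end of the tile containing `s`, so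
    -- that its tile number `i` is the shift by `-k / b` with `k = -i`.
    refine eq_zero_of_forall_inner_indicatorL2 (δ := 1 / b) (by positivity) c
      fun i t ht htub => ?_
    have htub' : t ⊆ Ioc (c - ((-i : ℤ) : ℝ) / b) (c - ((-i : ℤ) : ℝ) / b + 1 / b) := by
      simpa [div_eq_mul_inv] using htub
    have h2 : HasSum (fun p : ℤ × ℤ => inner ℂ (indicatorL2 hs hsub) (whSystem a b h p) *
        inner ℂ (whSystem a b g p) (indicatorL2 ht htub'))
        (inner ℂ (K (indicatorL2 hs hsub)) (indicatorL2 ht htub')) := by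
      simpa only [innerSL_apply_apply, inner_smul_right, RCLike.star_def, map_mul,
        inner_conj_symm] using ((hK (indicatorL2 hs hsub)).mapL
          (innerSL ℂ (indicatorL2 ht htub'))).star
    have h3 := eq_setIntegral_of_hasSum_inner_mul_inner ha hb g h (-i) hs ht hsub hca hcb htub' h2
    have h4 : inner ℂ (K (indicatorL2 hs hsub)) (indicatorL2 ht htub') =
        inner ℂ (indicatorL2 hs hsub) (indicatorL2 ht htub') := by
      rw [h3, inner_indicatorL2_indicatorL2_eq_ite (-i) hs ht hsub hcb htub',
        integral_congr_ae (g := fun _ => if -i = 0 then (b : ℂ) else 0)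
          (ae_restrict_of_ae ((H (-i)).mono fun x hx => hx.tsum_eq)),
        setIntegral_const, Complex.real_smul]
      split_ifs
      · rw [mul_left_comm, one_div_mul_cancel hb', mul_one]
      · simp
    change inner ℂ (indicatorL2 ht htub') _ = _
    rw [inner_sub_right, ← inner_conj_symm, h4, inner_conj_symm, sub_self]
  -- `K` fixes a total set of indicator functions; testing `K.adjoint y - y` against that set gives
  -- `K.adjoint = 1`.
  have hadj : ∀ y, K.adjoint y = y := fun y => by
    rw [← sub_eq_zero]
    refine eq_zero_of_forall_inner_indicatorL2 hδ0 0 fun j s hs hsub => ?_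
    rw [inner_sub_right, ContinuousLinearMap.adjoint_inner_right, hKs, sub_self]
  have hKx : K x = x := ext_inner_left ℂ fun y => by
    rw [← ContinuousLinearMap.adjoint_inner_left, hadj]
  simpa only [hKx] using hK x

/-- The `k`-th correlation of `g` and `h` is the periodization of `h · conj (T_{k/b} g)`, whose
Fourier coefficients are the inner products of `h` with the system on the dual lattice. -/
theorem ae_hasSum_correlation_iff_inner {a b : ℝ} (ha : 0 < a) (g h : L2) (k : ℤ) (w : ℂ) :
    (∀ᵐ x : ℝ,
      HasSum (fun n : ℤ => h (x - n * a) * starRingEnd ℂ (g (x - n * a - k / b))) w) ↔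
    ∀ m : ℤ, inner ℂ (modulate (m / a) (translate (k / b) g)) h =
      if m = 0 then a * w else 0 := by
  have key : ∀ m : ℤ, ∫ x, h x * starRingEnd ℂ (g (x - k / b)) * fourier (-m) (x : AddCircle a) =
      inner ℂ (modulate (m / a) (translate (k / b) g)) h := fun m => by
    rw [L2.inner_def]
    refine integral_congr_ae ?_
    filter_upwards [coeFn_modulate_translate (m / a) (k / b) g] with x hx
    have he : Complex.exp (2 * Real.pi * Complex.I * ((m / a : ℝ) : ℂ) * x) =
        fourier m (x : AddCircle a) := by
      rw [fourier_coe_apply]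
      congr 1
      push_cast
      ring
    rw [RCLike.inner_apply, hx, he, fourier_neg, map_mul]
    ring
  rw [ae_hasSum_translates_iff ha (integrable_mul_conj_translate h g (k / b)) w,
    ← (Equiv.neg ℤ).forall_congr_right]
  simp only [Equiv.neg_apply, key, neg_eq_zero]

end Duality

end WeylHeisenberg

end

theorem theorem4p1 (a b : ℝ) (ha : 0 < a) (hb : 0 < b) (g h : WeylHeisenberg.L2)
    (hgPF : g ∈ WeylHeisenberg.PF a b) (hhPF : h ∈ WeylHeisenberg.PF a b)
    (hg : WeylHeisenberg.IsFrame (WeylHeisenberg.whSystem a b g)) :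
    List.TFAE [
      WeylHeisenberg.IsAlternateDualFrame
        (WeylHeisenberg.whSystem a b h) (WeylHeisenberg.whSystem a b g),
      (∀ k : ℤ, k ≠ 0 → ∀ᵐ x : ℝ,
        HasSum (fun n : ℤ => h (x - n * a) * starRingEnd ℂ (g (x - n * a - k / b))) 0) ∧
      (∀ᵐ x : ℝ,
        HasSum (fun n : ℤ => h (x - n * a) * starRingEnd ℂ (g (x - n * a))) (b : ℂ)),
      ∃ f : WeylHeisenberg.L2, h = hg.frameOperatorEquiv.symm g + f ∧
        f ∈ (Submodule.span ℂ (Set.range fun p : ℤ × ℤ =>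
          WeylHeisenberg.modulate (p.2 / a) (WeylHeisenberg.translate (p.1 / b) g)))ᗮ] := by
  -- The two cases of the second condition are merged into one family indexed by all `k : ℤ`.
  have hcorr : ((∀ k : ℤ, k ≠ 0 → ∀ᵐ x : ℝ,
        HasSum (fun n : ℤ => h (x - n * a) * starRingEnd ℂ (g (x - n * a - k / b))) 0) ∧
      (∀ᵐ x : ℝ, HasSum (fun n : ℤ => h (x - n * a) * starRingEnd ℂ (g (x - n * a))) (b : ℂ))) ↔
      ∀ k : ℤ, ∀ᵐ x : ℝ,
        HasSum (fun n : ℤ => h (x - n * a) * starRingEnd ℂ (g (x - n * a - k / b)))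
          (if k = 0 then (b : ℂ) else 0) := by
    constructor
    · rintro ⟨H1, H2⟩ k
      rcases eq_or_ne k 0 with rfl | hk
      · simpa using H2
      · simpa [hk] using H1 k hk
    · intro H
      exact ⟨fun k hk => by simpa [hk] using H k, by simpa using H 0⟩
  rw [hcorr]
  -- The canonical dual window `S⁻¹ g` satisfies the correlation conditions.
  have hcan := WeylHeisenberg.ae_hasSum_correlation_of_hasSum ha hb
    hg.hasSum_whSystem_canonicalDual
  simp only [WeylHeisenberg.ae_hasSum_correlation_iff_inner ha] at hcan
  tfae_have 1 → 2 := fun H => WeylHeisenberg.ae_hasSum_correlation_of_hasSum ha hb H.2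
  tfae_have 2 → 1 := fun H => hhPF.isAlternateDualFrame hgPF
    (WeylHeisenberg.hasSum_of_ae_hasSum_correlation ha hb hgPF hhPF H)
  tfae_have 2 ↔ 3 := by
    simp only [WeylHeisenberg.ae_hasSum_correlation_iff_inner ha]
    constructor
    · refine fun H => ⟨h - hg.frameOperatorEquiv.symm g, (add_sub_cancel _ _).symm, ?_⟩
      rw [Submodule.mem_orthogonal]
      intro u hu
      induction hu using Submodule.span_induction with
      | mem u hu =>
        obtain ⟨p, rfl⟩ := hu
        rw [inner_sub_right, H, hcan, sub_self]
      | zero => exact inner_zero_left _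
      | add u v _ _ hu hv => rw [inner_add_left, hu, hv, add_zero]
      | smul r u _ hu => rw [inner_smul_left, hu, mul_zero]
    · rintro ⟨f, hf, hperp⟩ k m
      rw [hf, inner_add_right, hcan, add_eq_left]
      exact Submodule.inner_right_of_mem_orthogonal
        (Submodule.subset_span (Set.mem_range_self (k, m))) hperp
  tfae_finish
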